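/- Graphs are undirected and simple. A graph embeds in another if it is isomorphic to an induced subgraph of it. The age of a graph $G$ is the set of finite graphs (up to isomorphism) that embed in $G$, ordered by embeddability; it is wqo if it is well-quasi-ordered (equivalently here, has no infinite antichain). A graph $G$ is path-minimal if it contains finite induced paths of unbounded length and embeds in each of its induced subgraphs that has this property. A module of $G$ is a set $A$ of vertices such that each vertex outside $A$ is adjacent to all or to none of the vertices of $A$; $G$ is prime if it has more than three vertices and its only modules are $\emptyset$, the singletons and the whole vertex set. A word $u\colon\mathbb N\to\{0,1\}$ is uniformly recurrent if for every $n$ there is $m$ such that each factor of $u$ of length $n$ occurs in each factor of $u$ of length $m$. For a uniformly recurrent non-constant word $u$, let $l(u)$ be the maximum length of a factor of $u$ with all letters equal, and let $\varphi(u)=6$ if $u$ is alternating ($u=0101\dots$ or $u=1010\dots$) and $\varphi(u)=2(l(u)+1)+1$ otherwise. Let $G_u$ be the graph with vertex set $\{(n,m)\in\mathbb N\times\mathbb N: m\le n+\varphi(u)\}$ in which $(n,m)$ and $(n',m')$ are adjacent iff either $n=n'$ and $|m-m'|=1$, or $n\ne n'$ and $u(m)+u(m')\equiv 1 \pmod 2$.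 Theorem. For every uniformly recurrent non-constant word $u\colon\mathbb N\to\{0,1\}$ the graph $G_u$ is path-minimal and prime, and its age is wqo. Moreover, there is a set $U$ of $2^{\aleph_0}$ such words such that for all distinct $u,u'\in U$ the ages of $G_u$ and $G_{u'}$ are incomparable with respect to inclusion. In particular, there are $2^{\aleph_0}$ path-minimal prime graphs whose ages are pairwise incomparable and wqo. -/

import Mathlib

namespace PathAges

universe v w

/-- A finite graph up to isomorphism: a graph on some `Fin n`. -/
abbrev FinGraph : Type := Σ n : ℕ, SimpleGraph (Fin n)

/-- Embeddability of finite graphs (as induced subgraphs). -/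
def Embeds (H K : FinGraph) : Prop := Nonempty (H.2 ↪g K.2)

/-- The age of `G`: the finite graphs isomorphic to an induced subgraph of `G`. -/
def age {V : Type v} (G : SimpleGraph V) : Set FinGraph :=
  {H | Nonempty (H.2 ↪g G)}

/-- The age of `G` is well-quasi-ordered by embeddability. -/
def AgeWqo {V : Type v} (G : SimpleGraph V) : Prop :=
  (age G).PartiallyWellOrderedOn Embeds

/-- The ages of two graphs are incomparable with respect to set inclusion. -/
def AgeIncomparable {V : Type v} {W : Type w} (G : SimpleGraph V) (H : SimpleGraph W) : Prop :=
  ¬ age G ⊆ age H ∧ ¬ age H ⊆ age G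

/-- `G` contains finite induced paths of unbounded length. -/
def HasLongPaths {V : Type v} (G : SimpleGraph V) : Prop :=
  ∀ n : ℕ, ∃ m : ℕ, n ≤ m ∧ Nonempty (SimpleGraph.pathGraph m ↪g G)

/-- `G` contains finite induced paths of unbounded length and embeds in each of its induced
subgraphs with this property. -/
def PathMinimal {V : Type v} (G : SimpleGraph V) : Prop :=
  HasLongPaths G ∧ ∀ A : Set V, HasLongPaths (G.induce A) → Nonempty (G ↪g G.induce A)

/-- `A` is a module (autonomous set): each vertex outside `A` is adjacent to all vertices of `A`
or to none. -/
def IsModule {V : Type v} (G : SimpleGraph V) (A : Set V) : Prop :=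
  ∀ x, x ∉ A → (∀ a ∈ A, G.Adj x a) ∨ (∀ a ∈ A, ¬ G.Adj x a)

/-- A graph with more than three vertices is prime if its only modules are the empty set, the
singletons and the whole vertex set. -/
def IsPrimeGraph {V : Type v} (G : SimpleGraph V) : Prop :=
  3 < ENat.card V ∧
    ∀ A : Set V, IsModule G A → A = ∅ ∨ (∃ a, A = {a}) ∨ A = Set.univ

/-- For every `n` there is `m` such that each factor of `u` of length `n` occurs in each factor
of `u` of length `m`. -/
def UniformlyRecurrent {L : Type*} (u : ℕ → L) : Prop :=
  ∀ n : ℕ, ∃ m : ℕ, ∀ p q : ℕ,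
    ∃ r : ℕ, q ≤ r ∧ r + n ≤ q + m ∧ ∀ j < n, u (r + j) = u (p + j)

/-- The word `u` is not constant. -/
def Nonconstant {L : Type*} (u : ℕ → L) : Prop := ∃ p q : ℕ, u p ≠ u q

/-- The graph (labels forgotten) of the lexicographical sum over the chain `ℕ` of copies of the
path on `ℕ` labelled by `u`: vertex `(i, n)` is the vertex `n`, labelled `u n`, of the `i`-th copy,
and for `i < j` the vertices `(i, n)` and `(j, m)` are adjacent iff `star (u n) (u m)` is `1`. -/
def sumGraph {L : Type*} (star : L → L → Bool) (u : ℕ → L) : SimpleGraph (ℕ × ℕ) where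
  Adj x y :=
    (x.1 = y.1 ∧ (x.2 + 1 = y.2 ∨ y.2 + 1 = x.2)) ∨
    (x.1 < y.1 ∧ star (u x.2) (u y.2) = true) ∨
    (y.1 < x.1 ∧ star (u y.2) (u x.2) = true)
  symm := ⟨by
    rintro x y (⟨h, h'⟩ | h | h)
    · exact Or.inl ⟨h.symm, h'.symm⟩
    · exact Or.inr (Or.inr h)
    · exact Or.inr (Or.inl h)⟩
  loopless := ⟨by
    rintro x (⟨_, h⟩ | ⟨h, _⟩ | ⟨h, _⟩) <;> omega⟩

/-- The maximum length of a factor of `u` all of whose letters are `i`. (The maximum exists when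
`u` is uniformly recurrent and not constant.) -/
noncomputable def maxRun (u : ℕ → Bool) (i : Bool) : ℕ :=
  sSup {k : ℕ | ∃ p : ℕ, ∀ j < k, u (p + j) = i}

open Classical in
/-- `6` if `u` is one of the two alternating words, and `2 (l + 1) + 1` otherwise, where `l` is the
maximum length of a factor of `u` with all letters equal. -/
noncomputable def phi (u : ℕ → Bool) : ℕ :=
  if ∀ n, u (n + 1) ≠ u n then 6
  else 2 * (max (maxRun u false) (maxRun u true) + 1) + 1

/-- The restriction of the sum graph of `u`, for the Boolean sum (addition modulo two) on
`{0, 1}`, to the set of all `(n, m)` with `m ≤ n + phi u`. -/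
noncomputable def wordGraph (u : ℕ → Bool) :
    SimpleGraph {x : ℕ × ℕ | x.2 ≤ x.1 + phi u} :=
  (sumGraph Bool.xor u).induce {x : ℕ × ℕ | x.2 ≤ x.1 + phi u}

end PathAges

namespace PathAges

/-! For the Boolean sum, vertices of different copies are adjacent exactly when their labels differ,
so the order of the copies plays no role. A long induced path lies in a single copy up to two
vertices (`IsInducedPath.exists_copy`), and hence a third of it runs monotonically along an interval
of that copy.

Uniform recurrence over a finite alphabet makes factors wqo under occurrence. Two applications of
Higman's lemma, to the runs in a copy and then to the copies, give the wqo age through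
`exists_map_of_code_le`. Recurrence also finds every prefix of `u` in the long intervals that an
induced subgraph with long paths must contain, whence path-minimality. Primality holds because `phi
u` exceeds twice the longest constant run.

For incomparability, two long paths in different copies are embedded at once. Each serves as a
reference for the labels of the other, so a factor of `u` equals one of `u'` up to complement and
reversal, and the number of ones is kept or complemented (`exists_countTrue_of_age_subset`). In the
words `toeplitz s`, distinct `s` give different counts on suitable windows, wherever these start;
the density of ones is at most 2/5, which rules out complementation. -/

theorem sumGraph_xor_adj (u : ℕ → Bool) (x y : ℕ × ℕ) :
    (sumGraph Bool.xor u).Adj x y ↔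
      (x.1 = y.1 ∧ (x.2 + 1 = y.2 ∨ y.2 + 1 = x.2)) ∨ (x.1 ≠ y.1 ∧ u x.2 ≠ u y.2) := by
  simp only [sumGraph]
  cases u x.2 <;> cases u y.2 <;> simp

/-! ### Long induced paths in the sum graph -/

/-- The first `N` values of `g` form, in this order, an induced path of `G`. -/
structure IsInducedPath {V : Type*} (G : SimpleGraph V) (N : ℕ) (g : ℕ → V) : Prop where
  inj : ∀ i < N, ∀ j < N, g i = g j → i = j
  adj : ∀ i < N, ∀ j < N, (G.Adj (g i) (g j) ↔ i + 1 = j ∨ j + 1 = i)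

theorem IsInducedPath.mono {V : Type*} {G : SimpleGraph V} {N : ℕ} {g : ℕ → V}
    (h : IsInducedPath G N g) {M : ℕ} (hM : M ≤ N) : IsInducedPath G M g :=
  ⟨fun i hi j hj => h.inj i (by omega) j (by omega),
    fun i hi j hj => h.adj i (by omega) j (by omega)⟩

theorem exists_isInducedPath {V : Type*} {G : SimpleGraph V} [Nonempty V] {N : ℕ}
    (f : SimpleGraph.pathGraph N ↪g G) : ∃ g : ℕ → V, IsInducedPath G N g ∧
      ∀ i (hi : i < N), g i = f ⟨i, hi⟩ := by
  classical
  refine ⟨fun i => if h : i < N then f ⟨i, h⟩ else Classical.arbitrary V, ⟨?_, ?_⟩, ?_⟩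
  · intro i hi j hj h
    simp only [hi, hj, dif_pos] at h
    simpa using f.injective h
  · intro i hi j hj
    simp only [hi, hj, dif_pos]
    rw [f.map_adj_iff, SimpleGraph.pathGraph_adj]
  · intro i hi
    simp [hi]

theorem IsInducedPath.card_le_two {V : Type*} {G : SimpleGraph V} {N : ℕ} {g : ℕ → V}
    (h : IsInducedPath G N g) {i : ℕ} (hi : i < N) (s : Finset ℕ)
    (hs : ∀ j ∈ s, j < N ∧ G.Adj (g i) (g j)) : s.card ≤ 2 := by
  refine (Finset.card_le_card (t := {i + 1, i - 1}) fun j hj => ?_).trans Finset.card_le_two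
  obtain ⟨hj, ha⟩ := hs j hj
  have := (h.adj i hi j hj).1 ha
  simp only [Finset.mem_insert, Finset.mem_singleton]
  omega

/-- All but two vertices of an induced path with at least nine vertices lie in one copy. -/
theorem IsInducedPath.exists_copy {u : ℕ → Bool} {N : ℕ} {g : ℕ → ℕ × ℕ}
    (h : IsInducedPath (sumGraph Bool.xor u) N g) (hN : 9 ≤ N) :
    ∃ c e e', ∀ j < N, (g j).1 ≠ c → j = e ∨ j = e' := by
  classical
  let L : Bool → Finset ℕ := fun b => (Finset.range N).filter fun i => u (g i).2 = b
  have hL : ∀ b i, i ∈ L b ↔ i < N ∧ u (g i).2 = b := fun b i => by simp [L]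
  -- Five is what the count needs: a vertex of the other label is adjacent to all of `L b` outside
  -- its own copy, hence misses at most two of them there. Two such vertices in different copies
  -- would leave at most four elements in `L b`.
  obtain ⟨b, hb⟩ : ∃ b, 5 ≤ (L b).card := by
    by_contra hcon
    push Not at hcon
    have h1 : Finset.range N ⊆ L true ∪ L false := fun i hi => by
      rw [Finset.mem_union, hL, hL]
      cases u (g i).2 <;> simpa using hi
    have h2 := (Finset.card_le_card h1).trans (Finset.card_union_le _ _)
    have := hcon true
    have := hcon false
    simp only [Finset.card_range] at h2
    omega
  by_cases h0 : ∀ i < N, u (g i).2 = b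
  · refine ⟨(g 0).1, 0, 0, fun j hj hne => absurd ?_ hne⟩
    induction j with
    | zero => rfl
    | succ j ih =>
      have ha := (h.adj j (by omega) (j + 1) hj).2 (Or.inl rfl)
      rw [sumGraph_xor_adj, h0 j (by omega), h0 (j + 1) hj] at ha
      have hj' : (g j).1 = (g 0).1 := by
        by_contra hc
        exact hc (ih (by omega) hc)
      simp only [ne_eq, not_true_eq_false, and_false, or_false] at ha
      exact ha.1.symm.trans hj'
  · push Not at h0
    obtain ⟨i, hi, hib⟩ := h0
    have key : ∀ k < N, u (g k).2 ≠ b →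
        ((L b).filter fun j => (g j).1 ≠ (g k).1).card ≤ 2 := by
      intro k hk hkb
      refine h.card_le_two hk _ fun j hj => ?_
      rw [Finset.mem_filter, hL] at hj
      refine ⟨hj.1.1, ?_⟩
      rw [sumGraph_xor_adj]
      exact Or.inr ⟨hj.2.symm, by rw [hj.1.2]; exact hkb⟩
    refine ⟨(g i).1, i + 1, i - 1, fun j hj hne => ?_⟩
    have hjb : u (g j).2 = b := by
      by_contra hjb
      have h1 : L b ⊆ ((L b).filter fun k => (g k).1 ≠ (g i).1) ∪
          ((L b).filter fun k => (g k).1 ≠ (g j).1) := fun k hk => by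
        rw [Finset.mem_union]
        by_cases hki : (g k).1 = (g i).1
        · exact Or.inr (Finset.mem_filter.2 ⟨hk, by rw [hki]; exact hne.symm⟩)
        · exact Or.inl (Finset.mem_filter.2 ⟨hk, hki⟩)
      have h2 := (Finset.card_le_card h1).trans (Finset.card_union_le _ _)
      have := key i hi hib
      have := key j hj hjb
      omega
    have := (h.adj i hi j hj).1 (by
      rw [sumGraph_xor_adj]
      exact Or.inr ⟨hne.symm, by rw [hjb]; exact hib⟩)
    omega

theorem monotone_or_antitone_of_steps (h : ℕ → ℕ) (n : ℕ)
    (hinj : ∀ i < n, ∀ j < n, h i = h j → i = j)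
    (hstep : ∀ i, i + 1 < n → h i + 1 = h (i + 1) ∨ h (i + 1) + 1 = h i) :
    (∀ j < n, h j = h 0 + j) ∨ (∀ j < n, h j + j = h 0) := by
  induction n with
  | zero => simp
  | succ n ih =>
    have ih := ih (fun i hi j hj => hinj i (by omega) j (by omega))
      (fun i hi => hstep i (by omega))
    rcases n with _ | _ | n
    · left
      intro j hj
      obtain rfl : j = 0 := by omega
      rfl
    · rcases hstep 0 (by omega) with h1 | h1
      · left
        intro j hj
        obtain rfl | rfl : j = 0 ∨ j = 1 := by omega
        · rfl
        · exact h1.symm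
      · right
        intro j hj
        obtain rfl | rfl : j = 0 ∨ j = 1 := by omega
        · rfl
        · exact h1
    · have hs : h (n + 1) + 1 = h (n + 2) ∨ h (n + 2) + 1 = h (n + 1) := hstep (n + 1) (by omega)
      have hi : h (n + 2) = h n → n + 2 = n := hinj (n + 2) (by omega) n (by omega)
      rcases ih with ih | ih
      · left
        intro j hj
        rcases Nat.lt_succ_iff_lt_or_eq.1 hj with hj | rfl
        · exact ih j hj
        · have := ih (n + 1) (by omega)
          have := ih n (by omega)
          change h (n + 2) = h 0 + (n + 2)
          omega
      · right
        intro j hj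
        rcases Nat.lt_succ_iff_lt_or_eq.1 hj with hj | rfl
        · exact ih j hj
        · have := ih (n + 1) (by omega)
          have := ih n (by omega)
          change h (n + 2) + (n + 2) = h 0
          omega

/-- A long induced path has a long subpath which runs monotonically in one copy. -/
theorem IsInducedPath.exists_window {u : ℕ → Bool} {n : ℕ} {g : ℕ → ℕ × ℕ}
    (h : IsInducedPath (sumGraph Bool.xor u) (3 * n) g) (hn : 3 ≤ n) :
    ∃ c a p, a + n ≤ 3 * n ∧ (∀ j < n, (g (a + j)).1 = c) ∧
      ((∀ j < n, (g (a + j)).2 = p + j) ∨ (∀ j < n, (g (a + j)).2 + j = p)) := by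
  obtain ⟨c, e, e', hc⟩ := h.exists_copy (by omega)
  -- Of three disjoint windows, one avoids both exceptional vertices.
  obtain ⟨a, ha, hae⟩ : ∃ a, a + n ≤ 3 * n ∧ ∀ j < n, a + j ≠ e ∧ a + j ≠ e' := by
    by_contra hcon
    push Not at hcon
    obtain ⟨j0, h0, h0'⟩ := hcon 0 (by omega)
    obtain ⟨j1, h1, h1'⟩ := hcon n (by omega)
    obtain ⟨j2, h2, h2'⟩ := hcon (n + n) (by omega)
    omega
  have hcopy : ∀ j < n, (g (a + j)).1 = c := fun j hj => by
    by_contra hne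
    have := hc (a + j) (by omega) hne
    have := hae j hj
    omega
  refine ⟨c, a, (g (a + 0)).2, ha, hcopy, monotone_or_antitone_of_steps
    (fun j => (g (a + j)).2) n ?_ ?_⟩
  · intro i hi j hj hij
    have := h.inj (a + i) (by omega) (a + j) (by omega)
      (Prod.ext ((hcopy i hi).trans (hcopy j hj).symm) hij)
    omega
  · intro i hi
    have h1 := (h.adj (a + i) (by omega) (a + (i + 1)) (by omega)).2 (Or.inl rfl)
    rw [sumGraph_xor_adj] at h1
    rcases h1 with h1 | h1
    · exact h1.2
    · exact absurd ((hcopy i (by omega)).trans (hcopy (i + 1) hi).symm) h1.1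

/-! ### Well-quasi-order of the age -/

/-- `s` is dominated by `t`: some injection of `s` into `t` increases each element along `r`. -/
def FinsetLE {α : Type*} (r : α → α → Prop) (s t : Finset α) : Prop :=
  ∃ g : α → α, Set.InjOn g s ∧ ∀ a ∈ s, g a ∈ t ∧ r a (g a)

theorem FinsetLE.isPreorder {α : Type*} (r : α → α → Prop) [IsPreorder α r] :
    IsPreorder (Finset α) (FinsetLE r) where
  refl s := ⟨id, Set.injOn_id _, fun a ha => ⟨ha, refl_of r a⟩⟩
  trans s t w := by
    rintro ⟨g, hg, hg'⟩ ⟨k, hk, hk'⟩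
    refine ⟨k ∘ g, hk.comp hg fun a ha => (hg' a ha).1, fun a ha => ?_⟩
    exact ⟨(hk' _ (hg' a ha).1).1, trans_of r (hg' a ha).2 (hk' _ (hg' a ha).1).2⟩

theorem exists_injOn_of_sublistForall₂ {α : Type*} {r : α → α → Prop} {l l' : List α}
    (h : List.SublistForall₂ r l l') (hl : l.Nodup) (hl' : l'.Nodup) :
    ∃ g : α → α, Set.InjOn g {a | a ∈ l} ∧ ∀ a ∈ l, g a ∈ l' ∧ r a (g a) := by
  classical
  induction h with
  | nil => exact ⟨id, by simp, by simp⟩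
  | @cons a b l l' hab _ ih =>
    rw [List.nodup_cons] at hl hl'
    obtain ⟨g, hg, hg'⟩ := ih hl.2 hl'.2
    have hne : ∀ x ∈ l, x ≠ a := fun x hx hxa => hl.1 (hxa ▸ hx)
    have hval : ∀ x ∈ l, Function.update g a b x = g x := fun x hx =>
      Function.update_of_ne (hne x hx) _ _
    refine ⟨Function.update g a b, ?_, ?_⟩
    · intro x hx y hy hxy
      rw [Set.mem_ofPred_eq, List.mem_cons] at hx hy
      rcases hx with rfl | hx <;> rcases hy with rfl | hy
      · rfl
      · rw [hval y hy, Function.update_self] at hxy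
        exact absurd (hxy ▸ (hg' y hy).1) hl'.1
      · rw [hval x hx, Function.update_self] at hxy
        exact absurd (hxy ▸ (hg' x hx).1) hl'.1
      · rw [hval x hx, hval y hy] at hxy
        exact hg hx hy hxy
    · intro x hx
      rw [List.mem_cons] at hx
      rcases hx with rfl | hx
      · rw [Function.update_self]
        exact ⟨List.mem_cons_self, hab⟩
      · rw [hval x hx]
        exact ⟨List.mem_cons_of_mem _ (hg' x hx).1, (hg' x hx).2⟩
  | cons_right _ ih =>
    obtain ⟨g, hg, hg'⟩ := ih hl (List.nodup_cons.1 hl').2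
    exact ⟨g, hg, fun a ha => ⟨List.mem_cons_of_mem _ (hg' a ha).1, (hg' a ha).2⟩⟩

/-- Higman's lemma for finite sets. -/
theorem wellQuasiOrdered_finsetLE {α : Type*} {r : α → α → Prop} [IsPreorder α r]
    (h : WellQuasiOrdered r) : WellQuasiOrdered (FinsetLE r) := by
  intro f
  have h1 := Set.PartiallyWellOrderedOn.partiallyWellOrderedOn_sublistForall₂ r
    (Set.partiallyWellOrderedOn_univ_iff.2 h)
  obtain ⟨m, n, hmn, hr⟩ := h1.exists_lt (f := fun n => (f n).toList)
    (fun _ _ _ => Set.mem_univ _)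
  obtain ⟨g, hg, hg'⟩ := exists_injOn_of_sublistForall₂ hr (Finset.nodup_toList _)
    (Finset.nodup_toList _)
  refine ⟨m, n, hmn, g, ?_, ?_⟩
  · simpa [Set.InjOn] using hg
  · simpa using hg'

/-- The factor of `u` at the interval `I` (given by its start and length) occurs inside the
interval `J`. -/
def FactorLE {L : Type*} (u : ℕ → L) (I J : ℕ × ℕ) : Prop :=
  ∃ t, J.1 ≤ t ∧ t + I.2 ≤ J.1 + J.2 ∧ ∀ j < I.2, u (t + j) = u (I.1 + j)

theorem FactorLE.isPreorder {L : Type*} (u : ℕ → L) : IsPreorder (ℕ × ℕ) (FactorLE u) where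
  refl I := ⟨I.1, le_rfl, le_rfl, fun _ _ => rfl⟩
  trans I J K := by
    rintro ⟨t, h1, h2, h3⟩ ⟨s, h4, h5, h6⟩
    refine ⟨s + (t - J.1), by omega, by omega, fun j hj => ?_⟩
    rw [← h3 j hj, show s + (t - J.1) + j = s + (t - J.1 + j) by ring, h6 _ (by omega)]
    congr 1
    omega

/-- Any sufficiently long interval contains the first factor of the sequence. If no later interval
is that long, only finitely many words occur among them and one repeats. -/
theorem UniformlyRecurrent.wellQuasiOrdered_factorLE {L : Type*} [Finite L] {u : ℕ → L}
    (hu : UniformlyRecurrent u) : WellQuasiOrdered (FactorLE u) := by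
  intro f
  obtain ⟨m, hm⟩ := hu (f 0).2
  by_cases h : ∃ k, 0 < k ∧ m ≤ (f k).2
  · obtain ⟨k, hk, hmk⟩ := h
    obtain ⟨r, h1, h2, h3⟩ := hm (f 0).1 (f k).1
    exact ⟨0, k, hk, r, h1, by omega, h3⟩
  · push Not at h
    let c : ℕ → Fin m × (Fin m → L) := fun k =>
      (⟨(f (k + 1)).2, h _ (by omega)⟩, fun j => u ((f (k + 1)).1 + j))
    obtain ⟨k, k', hne, hk⟩ : ∃ k k', k < k' ∧ c k = c k' := by
      obtain ⟨k, k', hne, hk⟩ := Finite.exists_ne_map_eq_of_infinite c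
      rcases lt_or_gt_of_ne hne with h | h
      · exact ⟨k, k', h, hk⟩
      · exact ⟨k', k, h, hk.symm⟩
    rw [Prod.mk.injEq, Fin.mk.injEq] at hk
    refine ⟨k + 1, k' + 1, by omega, (f (k' + 1)).1, le_rfl, by omega, fun j hj => ?_⟩
    exact (congrFun hk.2 ⟨j, hj.trans (h _ (by omega))⟩).symm

/-- `I` (given by start and length) is a maximal interval contained in `S`. -/
structure IsRun (S : Finset ℕ) (I : ℕ × ℕ) : Prop where
  mem : ∀ k, I.1 ≤ k → k < I.1 + I.2 → k ∈ S
  pos : 0 < I.2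
  right : I.1 + I.2 ∉ S
  left : ∀ k, k + 1 = I.1 → k ∉ S

theorem IsRun.eq_of_touch {S : Finset ℕ} {I J : ℕ × ℕ} (hI : IsRun S I) (hJ : IsRun S J)
    {m k : ℕ} (hm : I.1 ≤ m ∧ m < I.1 + I.2) (hk : J.1 ≤ k ∧ k < J.1 + J.2)
    (h : m = k ∨ m + 1 = k) : I = J := by
  have h1 : I.1 = J.1 := by
    rcases lt_trichotomy I.1 J.1 with h1 | h1 | h1
    · exact absurd (hI.mem (J.1 - 1) (by omega) (by omega)) (hJ.left _ (by omega))
    · exact h1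
    · exact absurd (hJ.mem (I.1 - 1) (by omega) (by omega)) (hI.left _ (by omega))
  have h2 : I.1 + I.2 = J.1 + J.2 := by
    rcases lt_trichotomy (I.1 + I.2) (J.1 + J.2) with h2 | h2 | h2
    · exact absurd (hJ.mem (I.1 + I.2) (by omega) (by omega)) hI.right
    · exact h2
    · exact absurd (hI.mem (J.1 + J.2) (by omega) (by omega)) hJ.right
  exact Prod.ext h1 (by omega)

theorem exists_isRun {S : Finset ℕ} {m : ℕ} (hm : m ∈ S) :
    ∃ I, IsRun S I ∧ I.1 ≤ m ∧ m < I.1 + I.2 := by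
  classical
  have hlo : ∃ a, ∀ k, a ≤ k → k ≤ m → k ∈ S :=
    ⟨m, fun k h1 h2 => by rwa [le_antisymm h2 h1]⟩
  have hhi : ∃ b, m ≤ b ∧ b ∉ S := by
    obtain ⟨b, hb⟩ := S.bddAbove
    refine ⟨m + b + 1, by omega, fun h => ?_⟩
    have := hb h
    omega
  have ha := Nat.find_spec hlo
  have ha' : Nat.find hlo ≤ m := Nat.find_min' hlo fun k h1 h2 => by rwa [le_antisymm h2 h1]
  have hb := Nat.find_spec hhi
  have hmb : Nat.find hhi ≠ m := fun h => hb.2 (by rw [h]; exact hm)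
  generalize hA : Nat.find hlo = a at *
  generalize hB : Nat.find hhi = b at *
  refine ⟨(a, b - a), ⟨fun k h1 h2 => ?_, ?_, ?_, fun k hk hkS => ?_⟩, ha', ?_⟩
  · rcases le_or_gt k m with h | h
    · exact ha k h1 h
    · by_contra hk
      have := Nat.find_min' hhi ⟨h.le, hk⟩
      dsimp only at h1 h2
      omega
  · dsimp only
    omega
  · dsimp only
    rw [Nat.add_sub_cancel' (by omega)]
    exact hb.2
  · have := Nat.find_min' hlo (m := k) fun j h1 h2 => by
      rcases h1.eq_or_lt with rfl | h1
      · exact hkS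
      · exact ha j (by dsimp only at hk; omega) h2
    dsimp only at hk
    omega
  · dsimp only
    omega

theorem finite_setOf_isRun (S : Finset ℕ) : {I | IsRun S I}.Finite := by
  obtain ⟨b, hb⟩ := S.bddAbove
  refine (Set.finite_Iic ((b, b + 1) : ℕ × ℕ)).subset fun I hI => ?_
  have h1 := hI.pos
  have h2 := hb (hI.mem (I.1 + I.2 - 1) (by omega) (by omega))
  exact Prod.mk_le_mk.2 ⟨by omega, by omega⟩

/-- The maximal intervals contained in `S`. -/
noncomputable def runs (S : Finset ℕ) : Finset (ℕ × ℕ) := (finite_setOf_isRun S).toFinset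

theorem mem_runs {S : Finset ℕ} {I : ℕ × ℕ} : I ∈ runs S ↔ IsRun S I := by simp [runs]

/-- The vertices of `F` in the `i`-th copy. -/
def fiber (F : Finset (ℕ × ℕ)) (i : ℕ) : Finset ℕ := (F.filter fun x => x.1 = i).image Prod.snd

theorem mem_fiber {F : Finset (ℕ × ℕ)} {i m : ℕ} : m ∈ fiber F i ↔ (i, m) ∈ F := by
  simp [fiber]

/-- The finite set `F` of vertices, cut into the maximal intervals of its copies. -/
noncomputable def code (F : Finset (ℕ × ℕ)) : Finset (ℕ × Finset (ℕ × ℕ)) :=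
  F.image fun x => (x.1, runs (fiber F x.1))

theorem mem_code {F : Finset (ℕ × ℕ)} {c : ℕ × Finset (ℕ × ℕ)} (hc : c ∈ code F) :
    c.2 = runs (fiber F c.1) := by
  obtain ⟨x, -, rfl⟩ := Finset.mem_image.1 hc
  rfl

/-- Copies are sent to copies and each run is translated into its assigned run, with labels kept.
Distinct runs of a copy land in distinct runs of the target, which neither meet nor touch, so no new
path edge arises. -/
theorem exists_map_of_code_le {u : ℕ → Bool} {F F' : Finset (ℕ × ℕ)}
    (h : FinsetLE (fun c d : ℕ × Finset (ℕ × ℕ) => FinsetLE (FactorLE u) c.2 d.2)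
      (code F) (code F')) :
    ∃ ψ : ℕ × ℕ → ℕ × ℕ, Set.InjOn ψ F ∧ ∀ x ∈ F, ψ x ∈ F' ∧ ∀ y ∈ F,
      ((sumGraph Bool.xor u).Adj (ψ x) (ψ y) ↔ (sumGraph Bool.xor u).Adj x y) := by
  obtain ⟨G, hG, hG'⟩ := h
  have h1 : ∀ c ∈ code F, FinsetLE (FactorLE u) c.2 (G c).2 := fun c hc => (hG' c hc).2
  choose! g hg hg' using h1
  have h2 : ∀ c ∈ code F, ∀ I ∈ c.2, FactorLE u I (g c I) := fun c hc I hI => (hg' c hc I hI).2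
  choose! t ht1 ht2 ht3 using h2
  have h3 : ∀ x ∈ F, ∃ I, IsRun (fiber F x.1) I ∧ I.1 ≤ x.2 ∧ x.2 < I.1 + I.2 :=
    fun x hx => exists_isRun (mem_fiber.2 hx)
  choose! I hI hI1 hI2 using h3
  let C : ℕ × ℕ → ℕ × Finset (ℕ × ℕ) := fun x => (x.1, runs (fiber F x.1))
  have hC : ∀ x ∈ F, C x ∈ code F := fun x hx => Finset.mem_image_of_mem _ hx
  have hIC : ∀ x ∈ F, I x ∈ (C x).2 := fun x hx => mem_runs.2 (hI x hx)
  let ψ : ℕ × ℕ → ℕ × ℕ := fun x => ((G (C x)).1, t (C x) (I x) + (x.2 - (I x).1))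
  have hrun : ∀ x ∈ F, IsRun (fiber F' (ψ x).1) (g (C x) (I x)) := fun x hx => by
    have := (hg' _ (hC x hx) _ (hIC x hx)).1
    rwa [mem_code (hG' _ (hC x hx)).1, mem_runs] at this
  have hin : ∀ x ∈ F, (g (C x) (I x)).1 ≤ (ψ x).2 ∧
      (ψ x).2 < (g (C x) (I x)).1 + (g (C x) (I x)).2 := fun x hx => by
    have h1 := ht1 _ (hC x hx) _ (hIC x hx)
    have h2 := ht2 _ (hC x hx) _ (hIC x hx)
    have h3 := hI1 x hx
    have h4 := hI2 x hx
    dsimp only [ψ]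
    omega
  have hlab : ∀ x ∈ F, u (ψ x).2 = u x.2 := fun x hx => by
    have h3 := hI1 x hx
    have h4 := hI2 x hx
    have := ht3 _ (hC x hx) _ (hIC x hx) (x.2 - (I x).1) (by omega)
    rw [Nat.add_sub_cancel' h3] at this
    exact this
  have hcopy : ∀ x ∈ F, ∀ y ∈ F, ((ψ x).1 = (ψ y).1 ↔ x.1 = y.1) := fun x hx y hy => by
    constructor
    · intro h
      have h' : (G (C x)).1 = (G (C y)).1 := h
      -- A member of a code is determined by its copy index, so injectivity of `G` separates copies.
      have : G (C x) = G (C y) := Prod.ext h' (by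
        rw [mem_code (hG' _ (hC x hx)).1, mem_code (hG' _ (hC y hy)).1, h'])
      have := hG (hC x hx) (hC y hy) this
      exact (Prod.mk.injEq _ _ _ _ ▸ this : x.1 = y.1 ∧ _).1
    · intro h
      simp only [ψ, C, h]
  have hCeq : ∀ x y : ℕ × ℕ, x.1 = y.1 → C x = C y := fun x y h => by simp only [C, h]
  have hsame : ∀ x ∈ F, ∀ y ∈ F, x.1 = y.1 →
      ((ψ x).2 = (ψ y).2 ∨ (ψ x).2 + 1 = (ψ y).2 → I x = I y) := fun x hx y hy hxy h => by
    have hr := hrun y hy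
    rw [← (hcopy x hx y hy).2 hxy] at hr
    have := (hrun x hx).eq_of_touch hr (hin x hx) (hin y hy) h
    rw [hCeq x y hxy] at this
    refine hg _ (hC y hy) ?_ (hIC y hy) this
    have := hIC x hx
    rwa [hCeq x y hxy] at this
  have hsame' : ∀ x ∈ F, ∀ y ∈ F, x.1 = y.1 → (x.2 = y.2 ∨ x.2 + 1 = y.2) → I x = I y :=
      fun x hx y hy hxy h => by
    have hr := hI y hy
    rw [← hxy] at hr
    exact (hI x hx).eq_of_touch hr ⟨hI1 x hx, hI2 x hx⟩ ⟨hI1 y hy, hI2 y hy⟩ h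
  have hdiff : ∀ x ∈ F, ∀ y ∈ F, x.1 = y.1 → I x = I y →
      (ψ x).2 + y.2 = (ψ y).2 + x.2 := fun x hx y hy hxy h => by
    have h1 := hI1 x hx
    have h2 := hI1 y hy
    dsimp only [ψ]
    rw [hCeq x y hxy]
    rw [h] at h1 ⊢
    omega
  have hsucc : ∀ x ∈ F, ∀ y ∈ F, x.1 = y.1 →
      ((ψ x).2 + 1 = (ψ y).2 ↔ x.2 + 1 = y.2) := fun x hx y hy hxy => by
    constructor
    · intro h
      have := hdiff x hx y hy hxy (hsame x hx y hy hxy (Or.inr h))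
      omega
    · intro h
      have := hdiff x hx y hy hxy (hsame' x hx y hy hxy (Or.inr h))
      omega
  refine ⟨ψ, ?_, fun x hx => ⟨?_, fun y hy => ?_⟩⟩
  · intro x hx y hy hxy
    have h1 := (hcopy x hx y hy).1 (congrArg Prod.fst hxy)
    have h2 := congrArg Prod.snd hxy
    have := hdiff x hx y hy h1 (hsame x hx y hy h1 (Or.inl h2))
    exact Prod.ext h1 (by omega)
  · have := (hrun x hx).mem _ (hin x hx).1 (hin x hx).2
    rwa [mem_fiber] at this
  · rw [sumGraph_xor_adj, sumGraph_xor_adj, hlab x hx, hlab y hy, ne_eq, ne_eq, hcopy x hx y hy]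
    by_cases hxy : x.1 = y.1
    · rw [hsucc x hx y hy hxy, hsucc y hy x hx hxy.symm]
    · simp [hxy]

theorem UniformlyRecurrent.ageWqo_wordGraph {u : ℕ → Bool} (hu : UniformlyRecurrent u) :
    AgeWqo (wordGraph u) := by
  classical
  rw [AgeWqo, Set.partiallyWellOrderedOn_iff_exists_lt]
  intro f hf
  have := FactorLE.isPreorder u
  have := FinsetLE.isPreorder (FactorLE u)
  have : IsPreorder (ℕ × Finset (ℕ × ℕ)) (fun c d => FinsetLE (FactorLE u) c.2 d.2) :=
    { refl := fun c => refl_of (FinsetLE (FactorLE u)) c.2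
      trans := fun c d e h h' => trans_of (FinsetLE (FactorLE u)) h h' }
  have h1 := wellQuasiOrdered_finsetLE hu.wellQuasiOrdered_factorLE
  -- The order ignores the copy index, which only keeps copies with equal fibers apart in the finite
  -- set `code F`.
  have h2 : WellQuasiOrdered (fun c d : ℕ × Finset (ℕ × ℕ) => FinsetLE (FactorLE u) c.2 d.2) :=
    fun k => h1 fun n => (k n).2
  have e : ∀ n, Nonempty ((f n).2 ↪g sumGraph Bool.xor u) := fun n =>
    (hf n).map fun k => k.trans (SimpleGraph.Embedding.induce _)
  let e := fun n => (e n).some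
  let F : ℕ → Finset (ℕ × ℕ) := fun n => Finset.univ.image (e n)
  obtain ⟨m, n, hmn, hr⟩ := wellQuasiOrdered_finsetLE h2 fun n => code (F n)
  obtain ⟨ψ, hψ, hψ'⟩ := exists_map_of_code_le hr
  have hF : ∀ v, e m v ∈ F m := fun v => Finset.mem_image_of_mem _ (Finset.mem_univ v)
  have : ∀ v, ∃ w, e n w = ψ (e m v) := fun v => by
    simpa [F] using (hψ' _ (hF v)).1
  choose w hw using this
  refine ⟨m, n, hmn, ⟨⟨⟨w, fun v v' h => ?_⟩, fun {v v'} => ?_⟩⟩⟩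
  · have h' := congrArg (e n) h
    rw [hw, hw] at h'
    exact (e m).injective (hψ (hF v) (hF v') h')
  · change (f n).2.Adj (w v) (w v') ↔ _
    rw [← (e n).map_adj_iff, hw, hw, (hψ' _ (hF v)).2 _ (hF v'), (e m).map_adj_iff]

/-! ### Path-minimality -/

theorem wordGraph_adj (u : ℕ → Bool) (x y : {x : ℕ × ℕ | x.2 ≤ x.1 + phi u}) :
    (wordGraph u).Adj x y ↔
      (x.1.1 = y.1.1 ∧ (x.1.2 + 1 = y.1.2 ∨ y.1.2 + 1 = x.1.2)) ∨
        (x.1.1 ≠ y.1.1 ∧ u x.1.2 ≠ u y.1.2) :=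
  sumGraph_xor_adj u x.1 y.1

theorem hasLongPaths_wordGraph (u : ℕ → Bool) : HasLongPaths (wordGraph u) := by
  intro n
  have hlt (i : Fin n) : (i : ℕ) ≤ n + phi u := by omega
  refine ⟨n, le_rfl, ⟨⟨⟨fun i => ⟨(n, i), hlt i⟩, fun i j h => ?_⟩, fun {i j} => ?_⟩⟩⟩
  · simpa [Fin.ext_iff] using h
  · rw [SimpleGraph.pathGraph_adj]
    exact (wordGraph_adj u ⟨(n, i), hlt i⟩ ⟨(n, j), hlt j⟩).trans (by simp)

/-- An induced subgraph with long induced paths contains long intervals of far copies. -/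
theorem exists_interval_of_hasLongPaths {u : ℕ → Bool} {A : Set {x : ℕ × ℕ | x.2 ≤ x.1 + phi u}}
    (hA : HasLongPaths ((wordGraph u).induce A)) (n N : ℕ) :
    ∃ c p, N ≤ c ∧ ∀ j < n, (c, p + j) ∈ Subtype.val '' A := by
  -- A monotone stretch of `k` vertices in copy `c` reaches height at least `k - 1`, and heights
  -- there are at most `c + phi u`; this forces `N ≤ c`.
  let k := n + N + phi u + 3
  obtain ⟨m, hm, ⟨f⟩⟩ := hA (3 * k)
  let f' : SimpleGraph.pathGraph m ↪g sumGraph Bool.xor u :=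
    (f.trans (SimpleGraph.Embedding.induce A)).trans (SimpleGraph.Embedding.induce _)
  obtain ⟨g, hg, hgf⟩ := exists_isInducedPath f'
  obtain ⟨c, a, p, ha, hc, hp⟩ := (hg.mono hm).exists_window (by omega)
  have hmem : ∀ j < k, g (a + j) ∈ Subtype.val '' A := fun j hj => by
    rw [hgf (a + j) (by omega)]
    exact ⟨_, (f _).2, rfl⟩
  have hle : ∀ j < k, (g (a + j)).2 ≤ c + phi u := fun j hj => by
    obtain ⟨x, -, hx⟩ := hmem j hj
    rw [← hc j hj, ← hx]
    exact x.2
  rcases hp with hp | hp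
  · refine ⟨c, p, ?_, fun j hj => ?_⟩
    · have := hle (k - 1) (by omega)
      have := hp (k - 1) (by omega)
      omega
    · have := hmem j (by omega)
      rwa [show g (a + j) = (c, p + j) from Prod.ext (hc j (by omega)) (hp j (by omega))] at this
  · have h0 := hp (k - 1) (by omega)
    refine ⟨c, p - (k - 1), ?_, fun j hj => ?_⟩
    · have := hle 0 (by omega)
      have := hp 0 (by omega)
      omega
    · have := hmem (k - 1 - j) (by omega)
      have h1 := hp (k - 1 - j) (by omega)
      rwa [show g (a + (k - 1 - j)) = (c, p - (k - 1) + j) from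
        Prod.ext (hc _ (by omega)) (by dsimp only; omega)] at this

/-- Copy `k` of the graph reads the prefix of `u` of length `k + phi u + 1`. That prefix recurs
inside a long interval of `A`, in a copy that can be taken beyond those already used. -/
theorem UniformlyRecurrent.pathMinimal_wordGraph {u : ℕ → Bool} (hu : UniformlyRecurrent u) :
    PathMinimal (wordGraph u) := by
  refine ⟨hasLongPaths_wordGraph u, fun A hA => ?_⟩
  have key : ∀ k N, ∃ c r, N ≤ c ∧ ∀ j ≤ k + phi u,
      u (r + j) = u j ∧ (c, r + j) ∈ Subtype.val '' A := by
    intro k N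
    obtain ⟨m, hm⟩ := hu (k + phi u + 1)
    obtain ⟨c, p, hc, hp⟩ := exists_interval_of_hasLongPaths hA m N
    obtain ⟨r, h1, h2, h3⟩ := hm 0 p
    refine ⟨c, r, hc, fun j hj => ⟨?_, ?_⟩⟩
    · simpa using h3 j (by omega)
    · have := hp (r + j - p) (by omega)
      rwa [show p + (r + j - p) = r + j by omega] at this
  choose c r hc hr using key
  let N : ℕ → ℕ := fun k => Nat.rec 0 (fun k N => c k N + 1) k
  have hmono : StrictMono fun k => c k (N k) := strictMono_nat_of_lt_succ fun k =>
    Nat.lt_of_succ_le (hc (k + 1) (N (k + 1)))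
  have hσ : ∀ i j, c i (N i) = c j (N j) ↔ i = j := fun i j => hmono.injective.eq_iff
  have hmem : ∀ x : {x : ℕ × ℕ | x.2 ≤ x.1 + phi u},
      ∃ y : A, (y : {x : ℕ × ℕ | x.2 ≤ x.1 + phi u}).1 =
        (c x.1.1 (N x.1.1), r x.1.1 (N x.1.1) + x.1.2) := fun x => by
    obtain ⟨y, hy, hyx⟩ := (hr x.1.1 (N x.1.1) x.1.2 x.2).2
    exact ⟨⟨y, hy⟩, hyx⟩
  choose φ hφ using hmem
  refine ⟨⟨⟨φ, fun x y h => ?_⟩, fun {x y} => ?_⟩⟩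
  · have h1 := hφ x
    rw [h, hφ y, Prod.mk.injEq, hσ] at h1
    refine Subtype.ext (Prod.ext h1.1.symm ?_)
    have := h1.2
    rw [h1.1] at this
    omega
  · change (wordGraph u).Adj (φ x) (φ y) ↔ _
    rw [wordGraph_adj, wordGraph_adj, hφ, hφ]
    dsimp only
    rw [(hr _ _ _ x.2).1, (hr _ _ _ y.2).1, ne_eq, ne_eq, hσ]
    by_cases h : x.1.1 = y.1.1
    · simp only [h, true_and, not_true_eq_false, false_and, or_false]
      omega
    · simp [h]

/-! ### Primality -/

theorem UniformlyRecurrent.bddAbove_run {u : ℕ → Bool} (hu : UniformlyRecurrent u)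
    (hn : Nonconstant u) (b : Bool) : BddAbove {k | ∃ p, ∀ j < k, u (p + j) = b} := by
  obtain ⟨p, q, hpq⟩ := hn
  obtain ⟨s, hs⟩ : ∃ s, u s ≠ b := by
    by_contra h
    push Not at h
    exact hpq ((h p).trans (h q).symm)
  obtain ⟨m, hm⟩ := hu 1
  refine ⟨m, fun k ⟨t, ht⟩ => ?_⟩
  by_contra hk
  obtain ⟨r, h1, h2, h3⟩ := hm s t
  have h4 := ht (r - t) (by omega)
  rw [Nat.add_sub_cancel' h1] at h4
  exact hs (by simpa [h4] using (h3 0 one_pos).symm)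

theorem UniformlyRecurrent.exists_run_bound {u : ℕ → Bool} (hu : UniformlyRecurrent u)
    (hn : Nonconstant u) :
    ∃ l, 2 * l + 3 ≤ phi u ∧ ∀ b p k, (∀ j < k, u (p + j) = b) → k ≤ l := by
  refine ⟨max (maxRun u false) (maxRun u true), ?_, fun b p k h => ?_⟩
  · unfold phi
    split_ifs with h
    · have h1 : ∀ b, maxRun u b ≤ 1 := fun b => by
        refine csSup_le ⟨0, 0, by simp⟩ fun k ⟨p, hp⟩ => ?_
        by_contra hk
        exact h p ((hp 1 (by omega)).trans (hp 0 (by omega)).symm)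
      have := h1 false
      have := h1 true
      omega
    · omega
  · have h1 : k ≤ maxRun u b := le_csSup (hu.bddAbove_run hn b) ⟨p, h⟩
    cases b
    · exact h1.trans (le_max_left _ _)
    · exact h1.trans (le_max_right _ _)

/-- A module of a finite path with at least four vertices which has two elements is everything. -/
theorem path_module_eq_univ {M : ℕ} (hM : 3 ≤ M) {Q : ℕ → Prop}
    (hQ : ∀ p q z, Q p → Q q → z ≤ M → (z + 1 = p ∨ p + 1 = z) → ¬ (z + 1 = q ∨ q + 1 = z) → Q z)
    {p q : ℕ} (hpq : p < q) (hqM : q ≤ M) (hp : Q p) (hq : Q q) : ∀ k ≤ M, Q k := by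
  have hup : ∀ k, q + k ≤ M → Q (q + k) := by
    intro k
    induction k with
    | zero => exact fun _ => hq
    | succ k ih =>
      exact fun hk => hQ (q + k) p _ (ih (by omega)) hp hk (by omega) (by omega)
  have hdown : ∀ k ≤ p, Q (p - k) := by
    intro k
    induction k with
    | zero => exact fun _ => hp
    | succ k ih =>
      exact fun hk => hQ (p - k) q _ (ih (by omega)) hq (by omega) (by omega) (by omega)
  have h0 : Q 0 := by simpa using hdown p le_rfl
  have h1 : Q M := by simpa [Nat.add_sub_cancel' hqM] using hup (M - q) (by omega)
  intro k
  induction k with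
  | zero => exact fun _ => h0
  | succ k ih =>
    intro hk
    by_cases h2 : k + 1 = M
    · rwa [h2]
    -- Here `k + 1` is also adjacent to `M`, so the pair `M`, `0` distinguishes it instead.
    · by_cases h3 : k + 2 = M
      · exact hQ M 0 _ h1 h0 hk (by omega) (by omega)
      · exact hQ k M _ (ih (by omega)) h1 hk (by omega) (by omega)

theorem UniformlyRecurrent.isPrimeGraph_wordGraph {u : ℕ → Bool} (hu : UniformlyRecurrent u)
    (hn : Nonconstant u) : IsPrimeGraph (wordGraph u) := by
  obtain ⟨l, hl, hrun⟩ := hu.exists_run_bound hn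
  have hletter : ∀ b, ∃ m ≤ l, u m = b := fun b => by
    by_contra h
    push Not at h
    have := hrun (!b) 0 (l + 1) fun j hj => by
      have := h j (by omega)
      rw [zero_add]
      exact Bool.eq_not.2 this
    omega
  have hvert : ∀ b i, ∃ z : {x : ℕ × ℕ | x.2 ≤ x.1 + phi u}, z.1.1 = i ∧ u z.1.2 = b :=
    fun b i => by
      obtain ⟨m, hm, hb⟩ := hletter b
      exact ⟨⟨(i, m), show m ≤ i + phi u by omega⟩, rfl, hb⟩
  refine ⟨?_, fun A hA => ?_⟩
  · have : Infinite {x : ℕ × ℕ | x.2 ≤ x.1 + phi u} :=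
      Infinite.of_injective (fun i : ℕ => ⟨(i, 0), Nat.zero_le (i + phi u)⟩) fun i j h => by
        simpa using h
    rw [ENat.card_eq_top_of_infinite]
    exact ENat.natCast_lt_top 3
  have hmod : ∀ x ∈ A, ∀ y ∈ A, ∀ z, (wordGraph u).Adj z x → ¬ (wordGraph u).Adj z y → z ∈ A := by
    intro x hx y hy z h1 h2
    by_contra hz
    rcases hA z hz with h | h
    · exact h2 (h y hy)
    · exact h x hx h1
  by_cases hmix : ∃ x ∈ A, ∃ y ∈ A, u x.1.2 ≠ u y.1.2
  -- A vertex outside both copies is adjacent to exactly one of `x`, `y`, so it is absorbed. Applied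
  -- first to a fresh copy, this yields a mixed pair away from any given `z`.
  · have hstep : ∀ x ∈ A, ∀ y ∈ A, u x.1.2 ≠ u y.1.2 → ∀ z : {x : ℕ × ℕ | x.2 ≤ x.1 + phi u},
        z.1.1 ≠ x.1.1 → z.1.1 ≠ y.1.1 → z ∈ A := by
      intro x hx y hy hxy z h1 h2
      by_cases hz : u z.1.2 = u x.1.2
      · refine hmod y hy x hx z ?_ ?_
        · rw [wordGraph_adj]
          exact Or.inr ⟨h2, hz ▸ hxy⟩
        · rw [wordGraph_adj]
          simp [h1, hz]
      · refine hmod x hx y hy z ?_ ?_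
        · rw [wordGraph_adj]
          exact Or.inr ⟨h1, hz⟩
        · rw [wordGraph_adj]
          have : u z.1.2 = u y.1.2 := by
            revert hz hxy
            cases u z.1.2 <;> cases u x.1.2 <;> cases u y.1.2 <;> simp
          simp [h2, this]
    obtain ⟨x, hx, y, hy, hxy⟩ := hmix
    refine Or.inr (Or.inr (Set.eq_univ_of_forall fun z => ?_))
    obtain ⟨x', hx1, hx2⟩ := hvert true (x.1.1 + y.1.1 + z.1.1 + 1)
    obtain ⟨y', hy1, hy2⟩ := hvert false (x.1.1 + y.1.1 + z.1.1 + 1)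
    exact hstep x' (hstep x hx y hy hxy x' (by omega) (by omega))
      y' (hstep x hx y hy hxy y' (by omega) (by omega)) (by simp [hx2, hy2]) z
      (by omega) (by omega)
  · push Not at hmix
    by_cases hcopies : ∃ x ∈ A, ∃ y ∈ A, x.1.1 ≠ y.1.1
    · exfalso
      obtain ⟨x, hx, y, hy, hxy⟩ := hcopies
      -- A differently labelled vertex of this copy, not next to `x`, would distinguish `y` from `x`
      -- and so enter `A`. Thus removing `x` and its path neighbours leaves two constant runs. At
      -- least `2 * l + 4` vertices lose at most three, too many for two runs of length at most `l`.
      have hfar : ∀ m ≤ x.1.1 + phi u, m + 1 ≠ x.1.2 → x.1.2 + 1 ≠ m → u m = u x.1.2 := by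
        intro m hm h1 h2
        by_contra hne
        have hz := hmod y hy x hx ⟨(x.1.1, m), hm⟩
          ((wordGraph_adj u _ _).2 (Or.inr ⟨hxy, by rwa [← hmix x hx y hy]⟩))
          (by rw [wordGraph_adj]; simp [h1, h2])
        exact hne (hmix _ hz x hx)
      have h1 := hrun (u x.1.2) 0 (x.1.2 - 1) fun j hj =>
        hfar _ (by have := x.2; have : x.1.2 ≤ x.1.1 + phi u := this; omega) (by omega) (by omega)
      have h2 := hrun (u x.1.2) (x.1.2 + 2) (x.1.1 + phi u + 1 - (x.1.2 + 2)) fun j hj =>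
        hfar _ (by omega) (by omega) (by omega)
      omega
    · push Not at hcopies
      have hsub : A.Subsingleton := by
        intro x hx y hy
        by_contra hxy
        let Q : ℕ → Prop := fun m => ∃ z ∈ A, z.1 = (x.1.1, m)
        have hQ : ∀ a ∈ A, Q a.1.2 := fun a ha =>
          ⟨a, ha, Prod.ext (hcopies a ha x hx) rfl⟩
        have hcl : ∀ p q z, Q p → Q q → z ≤ x.1.1 + phi u → (z + 1 = p ∨ p + 1 = z) →
            ¬ (z + 1 = q ∨ q + 1 = z) → Q z := by
          rintro p q z ⟨a, ha, hap⟩ ⟨b, hb, hbq⟩ hz h1 h2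
          refine ⟨⟨(x.1.1, z), hz⟩, hmod a ha b hb _ ?_ ?_, rfl⟩
          · rw [wordGraph_adj, hap]
            exact Or.inl ⟨rfl, h1⟩
          · rw [wordGraph_adj, hbq]
            simp [h2]
        have hall : ∀ k ≤ x.1.1 + phi u, Q k := by
          have hx2 : x.1.2 ≤ x.1.1 + phi u := x.2
          have hy2 : y.1.2 ≤ x.1.1 + phi u := hcopies x hx y hy ▸ y.2
          have hne : x.1.2 ≠ y.1.2 := fun h =>
            hxy (Subtype.ext (Prod.ext (hcopies x hx y hy) h))
          rcases lt_or_gt_of_ne hne with h | h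
          · exact path_module_eq_univ (by omega) hcl h hy2 (hQ x hx) (hQ y hy)
          · exact path_module_eq_univ (by omega) hcl h hx2 (hQ y hy) (hQ x hx)
        obtain ⟨m, hm, hb⟩ := hletter (!(u x.1.2))
        obtain ⟨z, hz, hzm⟩ := hall m (by omega)
        have := hmix z hz x hx
        rw [hzm] at this
        simp [this] at hb
      rcases hsub.eq_empty_or_singleton with h | h
      · exact Or.inl h
      · exact Or.inr (Or.inl h)

/-! ### Counting ones through inclusion of ages -/

/-- The number of letters `true` in the factor of `u` of length `n` at `p`. -/
def countTrue (u : ℕ → Bool) (n p : ℕ) : ℕ := ∑ j ∈ Finset.range n, (u (p + j)).toNat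

theorem countTrue_eq_or_of_xor {u u' : ℕ → Bool} {n p p' : ℕ} (b : Bool)
    (h : (∀ j < n, u (p + j) = (b ^^ u' (p' + j))) ∨
      ∀ j < n, u (p + j) = (b ^^ u' (p' + (n - 1 - j)))) :
    countTrue u n p = countTrue u' n p' ∨ countTrue u n p + countTrue u' n p' = n := by
  have hsum : countTrue u n p = ∑ j ∈ Finset.range n, (b ^^ u' (p' + j)).toNat := by
    rcases h with h | h
    · exact Finset.sum_congr rfl fun j hj => by rw [h j (Finset.mem_range.1 hj)]
    · rw [← Finset.sum_range_reflect]
      exact Finset.sum_congr rfl fun j hj => by rw [h j (Finset.mem_range.1 hj)]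
  cases b
  · left
    simpa [countTrue] using hsum
  · right
    rw [hsum, countTrue, ← Finset.sum_add_distrib]
    calc _ = ∑ _j ∈ Finset.range n, 1 :=
          Finset.sum_congr rfl fun j _ => by cases u' (p' + j) <;> rfl
      _ = n := by simp

/-- If the age of the graph of `u` is contained in that of the graph of `u'`, then long factors
of `u` and of `u'` agree up to complementation and reversal. -/
theorem exists_countTrue_of_age_subset {u u' : ℕ → Bool} {n : ℕ} (hn : 3 ≤ n)
    (htrue : ∀ p, ∃ j < n, u (p + j) = true)
    (hfalse : ∀ p, ∃ i j k, i < j ∧ j < k ∧ k < n ∧ u (p + i) = false ∧ u (p + j) = false ∧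
      u (p + k) = false)
    (hage : age (wordGraph u) ⊆ age (wordGraph u')) :
    ∃ p p', countTrue u n p = countTrue u' n p' ∨
      countTrue u n p + countTrue u' n p' = n := by
  let N := 3 * n
  let e : Fin (N + N) → {x : ℕ × ℕ | x.2 ≤ x.1 + phi u} := fun i =>
    if i.1 < N then ⟨(N, min i.1 N), show min i.1 N ≤ N + phi u by omega⟩
    else ⟨(N + 1, i.1 - N), show i.1 - N ≤ N + 1 + phi u by omega⟩
  have he1 : ∀ i (hi : i < N), (e ⟨i, by omega⟩).1 = (N, i) := fun i hi => by
    simp only [e, if_pos hi]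
    rw [min_eq_left hi.le]
  have he2 : ∀ i (hi : i < N), (e ⟨N + i, by omega⟩).1 = (N + 1, i) := fun i hi => by
    simp [e]
  have hinj : Function.Injective e := by
    have hcase : ∀ i : Fin (N + N), (e i).1 = if i.1 < N then (N, i.1) else (N + 1, i.1 - N) := by
      intro i
      by_cases hi : i.1 < N
      · rw [if_pos hi]
        exact he1 i hi
      · simp [e, hi]
    intro i j hij
    have h := congrArg Subtype.val hij
    rw [hcase, hcase] at h
    split_ifs at h <;> simp at h <;> ext <;> omega
  obtain ⟨f⟩ : Nonempty ((wordGraph u).comap e ↪g wordGraph u') :=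
    @hage ⟨N + N, (wordGraph u).comap e⟩ ⟨⟨⟨e, hinj⟩, Iff.rfl⟩⟩
  have hf : ∀ i j, (sumGraph Bool.xor u').Adj (f i).1 (f j).1 ↔
      (wordGraph u).Adj (e i) (e j) := fun i j => f.map_adj_iff
  let g : ℕ → ℕ → ℕ × ℕ := fun k i => if h : k + i < N + N then (f ⟨k + i, h⟩).1 else (0, 0)
  have hg1 : ∀ i (hi : i < N), g 0 i = (f ⟨i, by omega⟩).1 := fun i hi => by
    simp [g, show i < N + N by omega]
  have hg2 : ∀ i (hi : i < N), g N i = (f ⟨N + i, by omega⟩).1 := fun i hi => by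
    simp [g, hi]
  have hval : ∀ i j, (f i).1 = (f j).1 → i = j := fun i j h => f.injective (Subtype.ext h)
  have hpath1 : IsInducedPath (sumGraph Bool.xor u') N (g 0) := by
    refine ⟨fun i hi j hj h => ?_, fun i hi j hj => ?_⟩
    · rw [hg1 i hi, hg1 j hj] at h
      simpa using hval _ _ h
    · rw [hg1 i hi, hg1 j hj, hf, wordGraph_adj, he1 i hi, he1 j hj]
      simp
  have hpath2 : IsInducedPath (sumGraph Bool.xor u') N (g N) := by
    refine ⟨fun i hi j hj h => ?_, fun i hi j hj => ?_⟩
    · rw [hg2 i hi, hg2 j hj] at h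
      simpa using hval _ _ h
    · rw [hg2 i hi, hg2 j hj, hf, wordGraph_adj, he2 i hi, he2 j hj]
      simp
  have hcross : ∀ i < N, ∀ j < N,
      ((sumGraph Bool.xor u').Adj (g 0 i) (g N j) ↔ u i ≠ u j) := fun i hi j hj => by
    rw [hg1 i hi, hg2 j hj, hf, wordGraph_adj, he1 i hi, he2 j hj]
    simp
  obtain ⟨c, a, p, ha, hc, hp⟩ := hpath1.exists_window hn
  obtain ⟨d, b, q, hb, hd, hq⟩ := hpath2.exists_window hn
  -- In a common copy, a vertex labelled `true` in the first window would have three neighbours on a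
  -- path, namely those labelled `false` in the second.
  have hcd : c ≠ d := by
    rintro rfl
    obtain ⟨x, hx, hxt⟩ := htrue a
    obtain ⟨i, j, k, hij, hjk, hk, hi', hj', hk'⟩ := hfalse b
    have hadj : ∀ y < n, u (b + y) = false → (g 0 (a + x)).2 + 1 = (g N (b + y)).2 ∨
        (g N (b + y)).2 + 1 = (g 0 (a + x)).2 := fun y hy hyf => by
      have h1 := (hcross (a + x) (by omega) (b + y) (by omega)).2 (by simp [hxt, hyf])
      rw [sumGraph_xor_adj, hc x hx, hd y hy] at h1
      simpa using h1
    have h1 := hadj i (by omega) hi'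
    have h2 := hadj j (by omega) hj'
    have h3 := hadj k hk hk'
    rcases hq with hq | hq
    · have := hq i (by omega)
      have := hq j (by omega)
      have := hq k hk
      omega
    · have := hq i (by omega)
      have := hq j (by omega)
      have := hq k hk
      omega
  -- Comparing with the single vertex `g N b` of the other copy shows that the two labellings differ
  -- by a constant.
  have hlab : ∀ j < n,
      u (a + j) = ((u b ^^ u' (g N b).2) ^^ u' (g 0 (a + j)).2) := fun j hj => by
    have h1 := hcross (a + j) (by omega) b (by omega)
    have h2 : (g N b).1 = d := hd 0 (by omega)
    rw [sumGraph_xor_adj, hc j hj, h2] at h1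
    simp only [hcd, false_and, ne_eq, not_false_eq_true, true_and, false_or] at h1
    revert h1
    cases u (a + j) <;> cases u b <;> cases u' (g N b).2 <;> cases u' (g 0 (a + j)).2 <;> simp
  rcases hp with hp | hp
  · refine ⟨a, p, countTrue_eq_or_of_xor (u b ^^ u' (g N b).2) (Or.inl fun j hj => ?_)⟩
    rw [hlab j hj, hp j hj]
  · refine ⟨a, p - (n - 1), countTrue_eq_or_of_xor (u b ^^ u' (g N b).2)
      (Or.inr fun j hj => ?_)⟩
    have h1 := hp j hj
    have h2 := hp (n - 1) (by omega)
    rw [hlab j hj, show (g 0 (a + j)).2 = p - (n - 1) + (n - 1 - j) by omega]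

/-! ### Toeplitz words with distinguishable counts -/

/-- The Toeplitz word over blocks `1 0 0 0 s₀ *`, where the holes `*` are filled by the
word of the shifted sequence. -/
def toeplitz (s : ℕ → Bool) (n : ℕ) : Bool :=
  if n % 6 = 0 then true
  else if n % 6 ≤ 3 then false
  else if n % 6 = 4 then s 0
  else toeplitz (fun k => s (k + 1)) (n / 6)
termination_by n
decreasing_by omega

theorem toeplitz_block (s : ℕ → Bool) (a r : ℕ) :
    toeplitz s (6 * a + r) =
      if r % 6 = 0 then true
      else if r % 6 ≤ 3 then false
      else if r % 6 = 4 then s 0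
      else toeplitz (fun k => s (k + 1)) (a + r / 6) := by
  rw [toeplitz, show (6 * a + r) % 6 = r % 6 by omega, show (6 * a + r) / 6 = a + r / 6 by omega]

/-- After `K` levels of filling, only the last position of each period `6 ^ K` is still a hole; the
strict bound on `j + 1` excludes it. -/
theorem toeplitz_periodic (K : ℕ) (s : ℕ → Bool) (t j : ℕ) (hj : j + 1 < 6 ^ K) :
    toeplitz s (6 ^ K * t + j) = toeplitz s j := by
  induction K generalizing s j with
  | zero => simp at hj
  | succ K ih =>
    have h : 6 ^ (K + 1) * t = 6 * (6 ^ K * t) := by ring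
    have h0 := toeplitz_block s 0 j
    rw [mul_zero, zero_add, zero_add] at h0
    rw [h, toeplitz_block, h0]
    by_cases h5 : j % 6 = 5
    · rw [ih _ (j / 6) (by rw [pow_succ] at hj; omega)]
    · have h1 : ¬ (j % 6 ≠ 0 ∧ ¬ j % 6 ≤ 3 ∧ j % 6 ≠ 4) := by omega
      split_ifs <;> tauto

/-- There are finitely many factors of length `n`; a gap is chosen for one occurrence of each, and
the largest serves all. -/
theorem uniformlyRecurrent_of_forall_factor {L : Type*} [Finite L] {u : ℕ → L}
    (h : ∀ n p, ∃ m, ∀ q, ∃ r, q ≤ r ∧ r + n ≤ q + m ∧ ∀ j < n, u (r + j) = u (p + j)) :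
    UniformlyRecurrent u := by
  intro n
  choose m hm using h n
  let F : ℕ → Fin n → L := fun p j => u (p + j)
  obtain ⟨M, hM⟩ := (Set.finite_range fun w : Set.range F => m w.2.choose).bddAbove
  refine ⟨M, fun p q => ?_⟩
  have hw : F p ∈ Set.range F := ⟨p, rfl⟩
  obtain ⟨r, h1, h2, h3⟩ := hm hw.choose q
  have h4 : m hw.choose ≤ M := hM ⟨⟨F p, hw⟩, rfl⟩
  refine ⟨r, h1, by omega, fun j hj => ?_⟩
  rw [h3 j hj]
  exact congrFun hw.choose_spec ⟨j, hj⟩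

theorem uniformlyRecurrent_toeplitz (s : ℕ → Bool) : UniformlyRecurrent (toeplitz s) := by
  refine uniformlyRecurrent_of_forall_factor fun n p => ?_
  have hK : p + n + 1 < 6 ^ (p + n + 1) := Nat.lt_pow_self (by norm_num)
  generalize hP : 6 ^ (p + n + 1) = P at hK
  refine ⟨P + p + n, fun q => ⟨P * (q / P + 1) + p, ?_, ?_, fun j hj => ?_⟩⟩
  · have := Nat.lt_mul_div_succ q (show 0 < P by omega)
    omega
  · have := Nat.mul_div_le q P
    rw [mul_add, mul_one]
    omega
  · rw [add_assoc, ← hP]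
    exact toeplitz_periodic _ s _ _ (by omega)

theorem nonconstant_toeplitz (s : ℕ → Bool) : Nonconstant (toeplitz s) :=
  ⟨0, 1, by unfold toeplitz; simp⟩

/-- Six consecutive positions meet each residue once, and the holes met are consecutive, starting
with number `p / 6`. -/
theorem countTrue_toeplitz (s : ℕ → Bool) (L p : ℕ) :
    countTrue (toeplitz s) (6 * L) p =
      L * (1 + (s 0).toNat) + countTrue (toeplitz fun k => s (k + 1)) L (p / 6) := by
  have hblock : ∀ a b, b < 6 → ∑ i ∈ Finset.range 6, (toeplitz s (6 * a + b + i)).toNat =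
      1 + (s 0).toNat + (toeplitz (fun k => s (k + 1)) a).toNat := by
    intro a b hb
    simp only [add_assoc (6 * a), toeplitz_block, Finset.sum_range_succ, Finset.sum_range_zero]
    interval_cases b <;> simp <;> ring
  unfold countTrue
  induction L with
  | zero => simp
  | succ L ih =>
    rw [mul_add, mul_one, Finset.sum_range_add, ih, Finset.sum_range_succ _ L]
    have h1 := hblock (p / 6 + L) (p % 6) (Nat.mod_lt _ (by norm_num))
    rw [show 6 * (p / 6 + L) + p % 6 = p + 6 * L by omega] at h1
    simp only [← add_assoc]
    rw [h1]
    ring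

/-- The densities 1/5 and 2/5 solve the recursion for `s` constantly `false` or `true`; the error
terms come from the single letter at `K = 0` and do not grow. -/
theorem countTrue_toeplitz_bounds (K : ℕ) (s : ℕ → Bool) (p : ℕ) :
    5 * countTrue (toeplitz s) (6 ^ K) p ≤ 2 * 6 ^ K + 3 ∧
      6 ^ K ≤ 5 * countTrue (toeplitz s) (6 ^ K) p + 1 := by
  induction K generalizing s p with
  | zero => cases h : toeplitz s p <;> simp [countTrue, h]
  | succ K ih =>
    have := ih (fun k => s (k + 1)) (p / 6)
    rw [pow_succ', countTrue_toeplitz]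
    have hs := Bool.toNat_le (s 0)
    have : 6 ^ K * (1 + (s 0).toNat) ≤ 6 ^ K * 2 := Nat.mul_le_mul_left _ (by omega)
    have : 6 ^ K * 1 ≤ 6 ^ K * (1 + (s 0).toNat) := Nat.mul_le_mul_left _ (by omega)
    omega

/-- Levels before `k` contribute equally. The exponent is `k + 2` because at level `k` a window of
six blocks gains 6 from `s' k`, while its six holes hold at most 3 ones; with one block, the hole
could cancel the gain. -/
theorem countTrue_toeplitz_lt (k : ℕ) (s s' : ℕ → Bool) (h : ∀ i < k, s i = s' i)
    (hs : s k = false) (hs' : s' k = true) (p p' : ℕ) :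
    countTrue (toeplitz s) (6 ^ (k + 2)) p < countTrue (toeplitz s') (6 ^ (k + 2)) p' := by
  induction k generalizing s s' p p' with
  | zero =>
    rw [show 6 ^ (0 + 2) = 6 * 6 ^ 1 by norm_num, countTrue_toeplitz, countTrue_toeplitz, hs, hs']
    have := (countTrue_toeplitz_bounds 1 (fun k => s (k + 1)) (p / 6)).1
    simp only [Bool.toNat_false, Bool.toNat_true]
    omega
  | succ k ih =>
    rw [show 6 ^ (k + 1 + 2) = 6 * 6 ^ (k + 2) by ring, countTrue_toeplitz, countTrue_toeplitz,
      h 0 (by omega)]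
    exact Nat.add_lt_add_left (ih _ _ (fun i hi => h (i + 1) (by omega)) hs hs' _ _) _

theorem exists_countTrue_toeplitz_ne {s s' : ℕ → Bool} (h : s ≠ s') :
    ∃ k, ∀ p p', countTrue (toeplitz s) (6 ^ (k + 2)) p ≠
      countTrue (toeplitz s') (6 ^ (k + 2)) p' := by
  classical
  have hex : ∃ k, s k ≠ s' k := Function.ne_iff.1 h
  refine ⟨Nat.find hex, fun p p' => ?_⟩
  have h1 : ∀ i < Nat.find hex, s i = s' i := fun i hi => not_not.1 (Nat.find_min hex hi)
  have h2 := Nat.find_spec hex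
  cases hs : s (Nat.find hex) <;> cases hs' : s' (Nat.find hex)
  · simp [hs, hs'] at h2
  · exact (countTrue_toeplitz_lt _ s s' h1 hs hs' p p').ne
  · exact (countTrue_toeplitz_lt _ s' s (fun i hi => (h1 i hi).symm) hs' hs p' p).ne'
  · simp [hs, hs'] at h2

theorem toeplitz_injective : Function.Injective toeplitz := by
  intro s s' h
  by_contra hne
  obtain ⟨k, hk⟩ := exists_countTrue_toeplitz_ne hne
  exact hk 0 0 (by rw [h])

theorem not_age_subset_of_ne {s s' : ℕ → Bool} (h : s ≠ s') :
    ¬ age (wordGraph (toeplitz s)) ⊆ age (wordGraph (toeplitz s')) := by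
  intro hage
  obtain ⟨k, hk⟩ := exists_countTrue_toeplitz_ne h
  have hpow : 36 ≤ 6 ^ (k + 2) := by
    rw [pow_add]
    have := Nat.one_le_pow k 6 (by norm_num)
    omega
  have htrue : ∀ p, ∃ j < 6 ^ (k + 2), toeplitz s (p + j) = true := by
    intro p
    refine ⟨6 - p % 6 + 0, by omega, ?_⟩
    rw [show p + (6 - p % 6 + 0) = 6 * (p / 6 + 1) + 0 by omega, toeplitz_block]
    simp
  have hfalse : ∀ p r, 1 ≤ r → r ≤ 3 → toeplitz s (p + (6 - p % 6 + r)) = false := by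
    intro p r h1 h3
    rw [show p + (6 - p % 6 + r) = 6 * (p / 6 + 1) + r by omega, toeplitz_block,
      if_neg (by omega), if_pos (by omega)]
  obtain ⟨p, p', hp⟩ := exists_countTrue_of_age_subset (by omega) htrue
    (fun p => ⟨6 - p % 6 + 1, 6 - p % 6 + 2, 6 - p % 6 + 3, by omega, by omega, by omega,
      hfalse p 1 (by omega) (by omega), hfalse p 2 (by omega) (by omega),
      hfalse p 3 (by omega) (by omega)⟩) hage
  rcases hp with hp | hp
  · exact hk p p' hp
  -- Two counts of density about 2/5 or less cannot add up to the whole window.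
  · have := (countTrue_toeplitz_bounds (k + 2) s p).1
    have := (countTrue_toeplitz_bounds (k + 2) s' p').1
    omega

end PathAges

theorem mainTheorem6 :
    (∀ u : ℕ → Bool, PathAges.UniformlyRecurrent u → PathAges.Nonconstant u →
      PathAges.PathMinimal (PathAges.wordGraph u) ∧
      PathAges.IsPrimeGraph (PathAges.wordGraph u) ∧
      PathAges.AgeWqo (PathAges.wordGraph u)) ∧
    ∃ U : Set (ℕ → Bool),
      Cardinal.mk U = Cardinal.continuum ∧
      (∀ u ∈ U, PathAges.UniformlyRecurrent u ∧ PathAges.Nonconstant u) ∧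
      U.Pairwise (fun u u' =>
        PathAges.AgeIncomparable (PathAges.wordGraph u) (PathAges.wordGraph u')) := by
  refine ⟨fun u hu hn => ⟨hu.pathMinimal_wordGraph, hu.isPrimeGraph_wordGraph hn,
    hu.ageWqo_wordGraph⟩, Set.range PathAges.toeplitz, ?_, ?_, ?_⟩
  · rw [Cardinal.mk_range_eq _ PathAges.toeplitz_injective]
    simp
  · rintro _ ⟨s, rfl⟩
    exact ⟨PathAges.uniformlyRecurrent_toeplitz s, PathAges.nonconstant_toeplitz s⟩
  · rintro _ ⟨s, rfl⟩ _ ⟨s', rfl⟩ hne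
    have h : s ≠ s' := fun h => hne (by rw [h])
    exact ⟨PathAges.not_age_subset_of_ne h, PathAges.not_age_subset_of_ne h.symm⟩
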